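/- For a finite tree $T$, let $\varphi(T)$ be the number of non-empty subtrees of $T$ (subgraphs of $T$ that are trees), and let the independence number of $T$ be the largest size of a set of pairwise non-adjacent vertices. For a nonincreasing degree sequence $\pi=(d_0,\dots,d_{n-1})$ of a tree, let $T^*_\pi$ be the tree with degree sequence $\pi$ obtained by breadth-first search: the root $v_0$ has $d_0$ children $v_1,\dots,v_{d_0}$, and then $v_1,v_2,\dots$ in turn receive the next $d_1-1,\ d_2-1,\dots$ vertices as their children. Let $n\ge 2$ and $\alpha$ be integers such that there is a tree of order $n$ with independence number $\alpha$, and let $\mathcal T_{n,\alpha}$ be the class of all such trees. Let $\pi=(\alpha,2,\dots,2,1,\dots,1)$, where the leading entry $\alpha$ is followed by $n-\alpha-1$ entries equal to $2$ and $\alpha$ entries equal to $1$, and put $T^*_\alpha=T^*_\pi$. Then: 1. $T^*_\alpha\in\mathcal T_{n,\alpha}$, its degree sequence is $\pi$, and $T^*_\alpha$ is isomorphic to the tree obtained from the star $K_{1,\alpha}$ by attaching one pendent edge to each of $n-\alpha-1$ distinct leaves of the star (for $n=2$ both objects are the single edge $K_2$). 2. Up to isomorphism, $T^*_\alpha$ is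 the only tree with the largest number of subtrees in $\mathcal T_{n,\alpha}$. 3. Every $T\in\mathcal T_{n,\alpha}$ satisfies $$\varphi(T)\le 2^{2\alpha-n+1}\,3^{\,n-\alpha-1}+2n-\alpha-2,$$ with equality if and only if $T$ is isomorphic to $T^*_\alpha$. -/

import Mathlib

/-- The number of (non-empty) subtrees of `G`: the number of subgraphs of `G` that are trees.
(A tree is by definition non-empty.) -/
noncomputable def subtreeCount {V : Type*} (G : SimpleGraph V) : ℕ :=
  Nat.card {H : G.Subgraph // H.coe.IsTree}

/-- The trees on the vertex set `V` with independence number `α`. -/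
def treesWithIndepNum (V : Type*) (α : ℕ) : Set (SimpleGraph V) :=
  {T | T.IsTree ∧ T.indepNum = α}

/-- `T` is a member of the class `C` with the largest number of subtrees in `C`. -/
def IsOptimal {V : Type*} (C : Set (SimpleGraph V)) (T : SimpleGraph V) : Prop :=
  T ∈ C ∧ ∀ T' ∈ C, subtreeCount T' ≤ subtreeCount T

open Classical in
/-- `π` is the degree sequence of `G`, written in nonincreasing order. -/
def HasDegreeSequence {V : Type*} [Fintype V] (G : SimpleGraph V) {n : ℕ} (π : Fin n → ℕ) : Prop :=
  Antitone π ∧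
    (Finset.univ.val.map fun v => G.degree v) = (Finset.univ.val.map π : Multiset ℕ)

/-- The breadth-first tree `T*_π` of a sequence `π = (d₀, …, d_{n-1})`. The vertices `0, 1, 2, …`
are numbered in the order in which breadth-first search labels them. The root `0` gets `d₀`
children, and then each vertex `k = 1, 2, …` in turn gets the next `d_k - 1` vertices as its
children. So after vertex `k` has been treated, exactly the vertices
`0, 1, …, d₀ + (d₁ - 1) + ⋯ + (d_k - 1)` have been labelled, and the parent of a vertex `j > 0` is
the first vertex `k` with `j ≤ d₀ + ⋯ + d_k - k`. -/
def bfsTree {n : ℕ} (π : Fin n → ℕ) : SimpleGraph (Fin n) :=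
  SimpleGraph.fromRel fun i j =>
    0 < (j : ℕ) ∧ IsLeast {k : Fin n | (j : ℕ) + (k : ℕ) ≤ ∑ l ∈ Finset.Iic k, π l} i

/-- The sequence `(α, 2, …, 2, 1, …, 1)` of length `n` in which the leading entry `α` is followed by
`n - α - 1` entries equal to `2` (at the positions `1, …, n - α - 1`) and `α` entries equal
to `1`. -/
def starSeq (n α : ℕ) : Fin n → ℕ := fun i =>
  if (i : ℕ) = 0 then α else if (i : ℕ) + α < n then 2 else 1

/-- The tree `T*_π` for `π = (α, 2, …, 2, 1, …, 1)`. -/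
def extremalTree (n α : ℕ) : SimpleGraph (Fin n) := bfsTree (starSeq n α)

/-- The graph obtained from the star `K_{1,a}`, with centre `inl ()` and leaves `inr (inl i)`, by
attaching one new pendant vertex `inr (inr j)` to the leaf number `j`, for each `j < k`
(meant for `k ≤ a`). -/
def starWithPendants (a k : ℕ) : SimpleGraph (Unit ⊕ Fin a ⊕ Fin k) :=
  SimpleGraph.fromRel fun x y =>
    match x, y with
    | .inl _, .inr (.inl _) => True
    | .inr (.inl i), .inr (.inr j) => (i : ℕ) = (j : ℕ)
    | _, _ => False

/-! A subtree of a tree is determined by its vertex set, so $\varphi(T)$ counts the vertex sets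
inducing a connected subgraph. Write $a$ for the independence number and $n = a + 1 + k$. In a
rooted tree with at least three vertices, look at a deepest leaf `l` and its neighbour `u`. Either
`u` carries a second leaf, and deleting `l` lowers $a$ by one and keeps $k$; or `u` has degree two,
and deleting `l` and `u` lowers both $a$ and $k$ by one, apart from the three-vertex path.

Let $P = 2^{a-k}3^k$. Restoring what was deleted multiplies the number of connected sets through a
fixed root by at most 2 in the first case and 3 in the second, so that number is at most $P$. The
total number grows by $1$ plus the rooted count at `u`, respectively by $3$ plus twice the rooted
count at the other neighbour of `u`. Hence it is at most $P + a + 2k$. The two bounds go through one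
induction (`SimpleGraph.IsAcyclic.bounds`), and the total bound needs the rooted one at every
vertex.

Equality makes each new piece hang from the centre, so the tree is covered by a spider with legs of
length one or two. Having exactly $a+1+k$ vertices, it is that spider. The spider's own count comes
from the same recursions, with equality. -/

open Classical in
/-- The vertex sets `S ⊆ W` inducing a connected subgraph of `G` and containing `R`. -/
noncomputable def connSets {V : Type*} (G : SimpleGraph V) (W R : Finset V) :
    Finset (Finset V) :=
  W.powerset.filter fun S => R ⊆ S ∧ (G.induce (S : Set V)).Connected

/-- The number of vertex sets `S ⊆ W` inducing a connected subgraph of `G` and containing `R`. -/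
noncomputable def connCount {V : Type*} (G : SimpleGraph V) (W R : Finset V) : ℕ :=
  (connSets G W R).card

open Classical in
/-- The independent sets of `G` contained in `W`. -/
noncomputable def indepSetsIn {V : Type*} (G : SimpleGraph V) (W : Finset V) :
    Finset (Finset V) :=
  W.powerset.filter fun S : Finset V => G.IsIndepSet (S : Set V)

/-- The largest size of an independent set of `G` contained in `W`. -/
noncomputable def indepOn {V : Type*} (G : SimpleGraph V) (W : Finset V) : ℕ :=
  (indepSetsIn G W).sup Finset.card

/-! ### Connected vertex sets and the effect of adding a leaf -/

section ConnCount

variable {V : Type*} {G : SimpleGraph V} {W R S : Finset V} {l u : V}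

lemma mem_connSets :
    S ∈ connSets G W R ↔ S ⊆ W ∧ R ⊆ S ∧ (G.induce (S : Set V)).Connected := by
  simp [connSets]

lemma connected_induce_singleton (v : V) :
    (G.induce ((({v} : Finset V)) : Set V)).Connected := by
  rw [Finset.coe_singleton]
  have : Nonempty ({v} : Set V) := ⟨⟨v, rfl⟩⟩
  exact SimpleGraph.Connected.mk SimpleGraph.Preconnected.of_subsingleton

lemma connSets_anti_right {R' : Finset V} (h : R ⊆ R') : connSets G W R' ⊆ connSets G W R := by
  intro S
  simp only [mem_connSets]
  exact fun ⟨h1, h2, h3⟩ => ⟨h1, h.trans h2, h3⟩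

lemma connCount_anti_right {R' : Finset V} (h : R ⊆ R') : connCount G W R' ≤ connCount G W R :=
  Finset.card_le_card (connSets_anti_right h)

lemma connCount_singleton (v : V) : connCount G {v} ∅ = 1 ∧ connCount G {v} {v} = 1 := by
  have h2 : connSets G {v} {v} = {{v}} := by
    ext S
    simp only [mem_connSets, Finset.mem_singleton]
    constructor
    · exact fun h => Finset.Subset.antisymm h.1 h.2.1
    · rintro rfl
      exact ⟨subset_rfl, subset_rfl, connected_induce_singleton v⟩
  have h1 : connSets G {v} ∅ = {{v}} := by
    rw [← h2]
    ext S
    simp only [mem_connSets, Finset.singleton_subset_iff, Finset.empty_subset, true_and,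
      and_congr_right_iff, iff_and_self]
    intro hS h
    obtain ⟨x, hx⟩ := h.nonempty
    have := hS hx
    rw [Finset.mem_singleton] at this
    exact this ▸ hx
  exact ⟨by unfold connCount; rw [h1]; simp, by unfold connCount; rw [h2]; simp⟩

variable [DecidableEq V]

lemma connected_induce_insert (hS : (G.induce (S : Set V)).Connected) (hu : u ∈ S)
    (h : G.Adj l u) : (G.induce ((insert l S : Finset V) : Set V)).Connected := by
  have := SimpleGraph.connected_induce_union (G := G) (v := l) (w := u) (s := {l}) (t := S)
    (SimpleGraph.Preconnected.of_subsingleton) hS.preconnected (by simp) (by simpa using hu) h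
  rwa [Finset.coe_insert, Set.insert_eq]

/-- The first step of a walk from `l` to a vertex of `S` lands on a neighbour of `l` in `S`, which
can only be `u`. -/
lemma mem_of_connected_induce_insert
    (h : (G.induce ((insert l S : Finset V) : Set V)).Connected) (hl : l ∉ S)
    (hS : S.Nonempty) (hadj : ∀ x ∈ S, G.Adj l x → x = u) : u ∈ S := by
  obtain ⟨s, hs⟩ := hS
  obtain ⟨p⟩ := h.preconnected ⟨l, by simp⟩ ⟨s, by simp [hs]⟩
  cases p with
  | nil => exact absurd hs hl
  | @cons _ v _ hv _ =>
    have hv' : G.Adj l v := hv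
    have hvS : (v : V) ∈ S := by
      have := v.2
      simp only [Finset.coe_insert, Set.mem_insert_iff, Finset.mem_coe] at this
      exact this.resolve_left hv'.ne'
    exact hadj _ hvS hv' ▸ hvS

lemma connected_induce_of_insert
    (h : (G.induce ((insert l S : Finset V) : Set V)).Connected)
    (hu : u ∈ S) (hadj : ∀ x ∈ S, G.Adj l x → x = u) : (G.induce (S : Set V)).Connected := by
  by_cases hl : l ∈ S
  · rwa [Finset.insert_eq_of_mem hl] at h
  -- The retraction that folds `l` onto `u`: every edge is sent to an edge or to a single vertex, so
  -- walks project into `S`.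
  let ret : ((insert l S : Finset V) : Set V) → (S : Set V) := fun x =>
    if hx : (x : V) ∈ S then ⟨x, hx⟩ else ⟨u, hu⟩
  have key : ∀ a b, (G.induce ((insert l S : Finset V) : Set V)).Walk a b →
      (G.induce (S : Set V)).Reachable (ret a) (ret b) := by
    intro a b p
    induction p with
    | nil => exact SimpleGraph.Reachable.refl _
    | @cons a v b hv p ih =>
      refine SimpleGraph.Reachable.trans ?_ ih
      have hv' : G.Adj (a : V) v := hv
      have ha := a.2
      have hvm := v.2
      simp only [Finset.coe_insert, Set.mem_insert_iff, Finset.mem_coe] at ha hvm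
      by_cases haS : (a : V) ∈ S <;> by_cases hvS : (v : V) ∈ S
      · refine SimpleGraph.Adj.reachable ?_
        simpa [ret, haS, hvS] using hv'
      · have hvl := hvm.resolve_right hvS
        have : (a : V) = u := hadj _ haS (by simpa only [hvl] using hv'.symm)
        have : ret a = ret v := by simp [ret, hvS, this]
        rw [this]
      · have hal := ha.resolve_right haS
        have : (v : V) = u := hadj _ hvS (by simpa only [hal] using hv')
        have : ret a = ret v := by simp [ret, haS, this]
        rw [this]
      · exact absurd ((ha.resolve_right haS).trans (hvm.resolve_right hvS).symm) hv'.ne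
  have : Nonempty (S : Set V) := ⟨⟨u, hu⟩⟩
  refine SimpleGraph.Connected.mk fun a b => ?_
  obtain ⟨p⟩ := h.preconnected ⟨a, by simp [a.2]⟩ ⟨b, by simp [b.2]⟩
  simpa [ret] using key _ _ p

/-- If every connected set through `r` also passes through `R`, then `R` has no vertex but `r`. -/
lemma mem_of_connCount_eq {r : V} (hr : r ∈ W)
    (h : connCount G W (insert u {r}) = connCount G W {r}) : u = r := by
  have := Finset.eq_of_subset_of_card_le
    (connSets_anti_right (G := G) (W := W) (Finset.subset_insert u {r})) h.ge
  have hmem : ({r} : Finset V) ∈ connSets G W {r} :=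
    mem_connSets.2 ⟨by simpa using hr, subset_rfl, connected_induce_singleton r⟩
  rw [← this, mem_connSets] at hmem
  simpa using hmem.2.1 (Finset.mem_insert_self u {r})

lemma connCount_insert (hl : l ∉ W) (R : Finset V) :
    connCount G (insert l W) R = connCount G W R + connCount G (insert l W) (insert l R) := by
  unfold connCount
  rw [← Finset.card_union_of_disjoint]
  · congr 1
    ext S
    simp only [mem_connSets, Finset.mem_union, Finset.insert_subset_iff]
    constructor
    · rintro ⟨h1, h2, h3⟩
      by_cases h : l ∈ S
      · exact Or.inr ⟨h1, ⟨h, h2⟩, h3⟩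
      · exact Or.inl ⟨(Finset.subset_insert_iff_of_notMem h).1 h1, h2, h3⟩
    · rintro (⟨h1, h2, h3⟩ | ⟨h1, ⟨-, h2⟩, h3⟩)
      · exact ⟨h1.trans (Finset.subset_insert _ _), h2, h3⟩
      · exact ⟨h1, h2, h3⟩
  · rw [Finset.disjoint_left]
    intro S h1 h2
    simp only [mem_connSets, Finset.insert_subset_iff] at h1 h2
    exact hl (h1.1 h2.2.1.1)

/-- Removing the leaf `l` from a connected set leaves either nothing, possible only when `R` is
empty, or a connected set through `u`; conversely `l` can be added to any of the latter. -/
lemma connCount_insert_insert (hl : l ∉ W) (hu : u ∈ W) (hR : R ⊆ W)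
    (hadj : ∀ x ∈ W, G.Adj l x ↔ x = u) :
    connCount G (insert l W) (insert l R) =
      (if R = ∅ then 1 else 0) + connCount G W (insert u R) := by
  have hlR : l ∉ R := fun h => hl (hR h)
  have : connSets G (insert l W) (insert l R) =
      (if R = ∅ then {{l}} else ∅) ∪
        (connSets G W (insert u R)).image (insert l) := by
    ext S
    simp only [mem_connSets, Finset.mem_union, Finset.mem_image, Finset.insert_subset_iff]
    constructor
    · rintro ⟨h1, ⟨h2, h3⟩, h4⟩
      have hS : insert l (S.erase l) = S := Finset.insert_erase h2
      have hSW : S.erase l ⊆ W := by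
        intro x hx
        rw [Finset.mem_erase] at hx
        exact (Finset.mem_insert.1 (h1 hx.2)).resolve_left hx.1
      have hRS : R ⊆ S.erase l := Finset.subset_erase.2 ⟨h3, hlR⟩
      rcases (S.erase l).eq_empty_or_nonempty with he | he
      · left
        rw [he, Finset.subset_empty] at hRS
        rw [he] at hS
        simp [hRS, ← hS]
      · right
        have hadj' : ∀ x ∈ S.erase l, G.Adj l x → x = u := fun x hx => (hadj x (hSW hx)).1
        rw [← hS] at h4
        have huS := mem_of_connected_induce_insert h4 (Finset.notMem_erase _ _) he hadj'
        exact ⟨S.erase l, ⟨hSW, ⟨huS, hRS⟩, connected_induce_of_insert h4 huS hadj'⟩, hS⟩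
    · rintro (h | ⟨S', ⟨h1, ⟨h2, h3⟩, h4⟩, rfl⟩)
      · split_ifs at h with hR0
        · rw [Finset.mem_singleton] at h
          subst h hR0
          exact ⟨by simp, by simp, connected_induce_singleton l⟩
        · simp at h
      · exact ⟨Finset.insert_subset_insert _ h1,
          ⟨Finset.mem_insert_self _ _, h3.trans (Finset.subset_insert _ _)⟩,
          connected_induce_insert h4 h2 ((hadj u hu).2 rfl)⟩
  unfold connCount
  rw [this, Finset.card_union_of_disjoint, Finset.card_image_of_injOn]
  · congr 1
    split_ifs <;> simp
  · intro S hS S' hS' h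
    simp only [Finset.mem_coe, mem_connSets] at hS hS'
    have h' : insert l S = insert l S' := h
    rw [← Finset.erase_insert (fun h => hl (hS.1 h)), h',
      Finset.erase_insert (fun h => hl (hS'.1 h))]
  · split_ifs with h
    · simp only [Finset.disjoint_singleton_left, Finset.mem_image, mem_connSets, not_exists,
        not_and, and_imp, Finset.insert_subset_iff]
      intro S hS huS _ _ h
      have : u ∈ ({l} : Finset V) := h ▸ Finset.mem_insert_of_mem huS
      rw [Finset.mem_singleton] at this
      exact hl (this ▸ hu)
    · simp

lemma connCount_insert_empty (hl : l ∉ W) (hu : u ∈ W) (hadj : ∀ x ∈ W, G.Adj l x ↔ x = u) :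
    connCount G (insert l W) ∅ = connCount G W ∅ + 1 + connCount G W {u} := by
  rw [connCount_insert hl, connCount_insert_insert hl hu (by simp) hadj]
  simp [add_assoc]

lemma connCount_insert_singleton {r : V} (hl : l ∉ W) (hu : u ∈ W) (hr : r ∈ W)
    (hadj : ∀ x ∈ W, G.Adj l x ↔ x = u) :
    connCount G (insert l W) {r} = connCount G W {r} + connCount G W (insert u {r}) := by
  rw [connCount_insert hl, connCount_insert_insert hl hu (by simpa using hr) hadj]
  simp

section Pair

variable {w r : V} (hu : u ∉ W) (hl : l ∉ insert u W) (hw : w ∈ W)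
  (hadjl : ∀ x ∈ insert u W, G.Adj l x ↔ x = u) (hadju : ∀ x ∈ W, G.Adj u x ↔ x = w)
include hu hl hw hadjl hadju

/-- The new sets are `{u}`, `{l}`, `{u, l}`, and each connected set through `w` enlarged by `u` or
by both `u` and `l`. -/
lemma connCount_insert_pair_empty :
    connCount G (insert l (insert u W)) ∅ = connCount G W ∅ + 3 + 2 * connCount G W {w} := by
  have h1 : connCount G (insert u W) {u} = 1 + connCount G W {w} := by
    have := connCount_insert_insert hu hw (Finset.empty_subset W) hadju
    simpa using this
  rw [connCount_insert_empty hl (Finset.mem_insert_self _ _) hadjl,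
    connCount_insert_empty hu hw hadju, h1]
  ring

lemma connCount_insert_pair_singleton (hr : r ∈ W) :
    connCount G (insert l (insert u W)) {r} =
      connCount G W {r} + 2 * connCount G W (insert w {r}) := by
  rw [connCount_insert_singleton hl (Finset.mem_insert_self _ _) (Finset.mem_insert_of_mem hr)
    hadjl, connCount_insert_insert hu hw (by simpa using hr) hadju,
    connCount_insert_singleton hu hw hr hadju]
  simp
  ring

end Pair

end ConnCount

/-! ### Independence number under deletion of a twin leaf or a pendant pair -/

section IndepOn

variable {V : Type*} {G : SimpleGraph V} {W S : Finset V} {l l' u : V}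

lemma mem_indepSetsIn : S ∈ indepSetsIn G W ↔ S ⊆ W ∧ G.IsIndepSet (S : Set V) := by
  simp [indepSetsIn]

lemma card_le_indepOn (hS : S ⊆ W) (h : G.IsIndepSet (S : Set V)) : S.card ≤ indepOn G W :=
  Finset.le_sup (f := Finset.card) (mem_indepSetsIn.2 ⟨hS, h⟩)

lemma exists_card_eq_indepOn (G : SimpleGraph V) (W : Finset V) :
    ∃ S ⊆ W, G.IsIndepSet (S : Set V) ∧ S.card = indepOn G W := by
  obtain ⟨S, hS, h⟩ := Finset.exists_mem_eq_sup (indepSetsIn G W)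
    ⟨∅, mem_indepSetsIn.2 ⟨by simp, by simp [SimpleGraph.isIndepSet_iff]⟩⟩ Finset.card
  rw [mem_indepSetsIn] at hS
  exact ⟨S, hS.1, hS.2, h.symm⟩

lemma indepOn_univ [Fintype V] (G : SimpleGraph V) : indepOn G Finset.univ = G.indepNum := by
  refine le_antisymm ?_ ?_
  · obtain ⟨S, hS, hi, hc⟩ := exists_card_eq_indepOn G Finset.univ
    exact hc ▸ hi.card_le_indepNum
  · obtain ⟨S, hS⟩ := G.exists_isNIndepSet_indepNum
    exact hS.card_eq ▸ card_le_indepOn (Finset.subset_univ _) hS.isIndepSet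

variable [DecidableEq V]

lemma isIndepSet_insert_of_forall_not_adj (hS : G.IsIndepSet (S : Set V))
    (h : ∀ x ∈ S, ¬ G.Adj l x) : G.IsIndepSet ((insert l S : Finset V) : Set V) := by
  rw [Finset.coe_insert, SimpleGraph.isIndepSet_iff]
  exact Set.pairwise_insert.2 ⟨hS, fun x hx _ => ⟨h x hx, fun h' => h x hx h'.symm⟩⟩

lemma indepOn_insert_of_twin (hl : l ∉ W) (hl' : l' ∈ W) (hlu : l' ≠ u)
    (hadj : ∀ x ∈ W, G.Adj l x ↔ x = u) (hadj' : ∀ x ∈ W, G.Adj l' x ↔ x = u) :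
    indepOn G (insert l W) = indepOn G W + 1 := by
  refine le_antisymm ?_ ?_
  · obtain ⟨S, hS, hi, hc⟩ := exists_card_eq_indepOn G (insert l W)
    rw [← hc]
    have : (S.erase l).card ≤ indepOn G W := card_le_indepOn
      (Finset.subset_insert_iff.1 hS) (hi.mono (by simp))
    have := Finset.pred_card_le_card_erase (s := S) (a := l)
    omega
  · obtain ⟨S, hS, hi, hc⟩ := exists_card_eq_indepOn G W
    obtain ⟨S', hS', hi', hc', huS'⟩ : ∃ S' ⊆ W, G.IsIndepSet (S' : Set V) ∧
        S'.card = S.card ∧ u ∉ S' := by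
      -- If a maximum independent set uses `u`, exchange `u` for the leaf `l'`; then `l` can be
      -- added.
      by_cases hu : u ∈ S
      · have hl'S : l' ∉ S := fun h => hi h hu hlu ((hadj' u (hS hu)).2 rfl)
        refine ⟨insert l' (S.erase u), ?_, ?_, ?_, ?_⟩
        · exact Finset.insert_subset hl' ((Finset.erase_subset _ _).trans hS)
        · refine isIndepSet_insert_of_forall_not_adj (hi.mono (by simp)) fun x hx h => ?_
          rw [Finset.mem_erase] at hx
          exact hx.1 ((hadj' x (hS hx.2)).1 h)
        · rw [Finset.card_insert_of_notMem (by simp [hl'S]), Finset.card_erase_add_one hu]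
        · simp [hlu.symm]
      · exact ⟨S, hS, hi, rfl, hu⟩
    rw [← hc, ← hc', ← Finset.card_insert_of_notMem (fun h => hl (hS' h))]
    refine card_le_indepOn (Finset.insert_subset_insert _ hS')
      (isIndepSet_insert_of_forall_not_adj hi' fun x hx h => ?_)
    exact huS' ((hadj x (hS' hx)).1 h ▸ hx)

lemma indepOn_insert_pair (hl : l ∉ insert u W)
    (hadj : ∀ x ∈ insert u W, G.Adj l x ↔ x = u) (hu : u ∉ W) :
    indepOn G (insert l (insert u W)) = indepOn G W + 1 := by
  have hlu : G.Adj l u := (hadj u (Finset.mem_insert_self _ _)).2 rfl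
  refine le_antisymm ?_ ?_
  · obtain ⟨S, hS, hi, hc⟩ := exists_card_eq_indepOn G (insert l (insert u W))
    rw [← hc]
    have h1 : ((S.erase l).erase u).card ≤ indepOn G W := card_le_indepOn
      (Finset.subset_insert_iff.1 (Finset.subset_insert_iff.1 hS))
      (hi.mono fun x hx => by simp at hx; tauto)
    by_cases h : l ∈ S
    · have hu : u ∉ S := fun hu => hi h hu hlu.ne hlu
      rw [Finset.erase_eq_of_notMem (by simp [hu])] at h1
      rw [Finset.card_erase_of_mem h] at h1
      omega
    · rw [Finset.erase_eq_of_notMem h] at h1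
      have := Finset.pred_card_le_card_erase (s := S) (a := u)
      omega
  · obtain ⟨S, hS, hi, hc⟩ := exists_card_eq_indepOn G W
    have hSW : S ⊆ insert u W := hS.trans (Finset.subset_insert _ _)
    rw [← hc, ← Finset.card_insert_of_notMem (fun h => hl (hSW h))]
    refine card_le_indepOn (Finset.insert_subset_insert _ hSW)
      (isIndepSet_insert_of_forall_not_adj hi fun x hx h => ?_)
    exact hu ((hadj x (hSW hx)).1 h ▸ hS hx)

lemma indepOn_pair (h : G.Adj l u) : indepOn G {l, u} = 1 := by
  have := indepOn_insert_pair (W := ∅) (G := G) (l := l) (u := u) (by simp [h.ne])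
    (by simp [h]) (by simp)
  obtain ⟨S, hS, -, hc⟩ := exists_card_eq_indepOn G (∅ : Finset V)
  rw [Finset.subset_empty.1 hS, Finset.card_empty] at hc
  rw [← hc] at this
  simpa using this

end IndepOn

/-! ### Deepest leaves of a rooted tree -/

section Structure

variable {V : Type*} {G : SimpleGraph V}

/-- A shortest path from `r` to a neighbour of `v` nearer to `r` avoids `v`, so that neighbour is
the penultimate vertex of the path from `r` to `v`: parents are unique. -/
lemma SimpleGraph.IsTree.eq_of_adj_of_dist_lt (hG : G.IsTree) {r v x y : V}
    (hx : G.Adj v x) (hy : G.Adj v y)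
    (hdx : G.dist r x < G.dist r v) (hdy : G.dist r y < G.dist r v) : x = y := by
  classical
  obtain ⟨p, hp, -⟩ := hG.connected.exists_path_of_dist r v
  have key : ∀ z, G.Adj v z → G.dist r z < G.dist r v → z = p.penultimate := by
    intro z hz hdz
    obtain ⟨q, hq, hql⟩ := hG.connected.exists_path_of_dist r z
    refine hG.isAcyclic.eq_penultimate_of_adj_end hp hz
      (hG.isAcyclic.mem_support_of_ne_mem_support_of_adj_of_isPath hp hq hz fun hv => ?_)
    have h1 := SimpleGraph.dist_le (q.takeUntil v hv)
    have h2 := q.length_takeUntil_le_length hv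
    omega
  rw [key x hx hdx, key y hy hdy]

/-- In a tree with at least three vertices, there are two leaves other than `r` at the same
vertex, or there is a leaf other than `r` whose neighbour is not `r` and has degree two. -/
lemma SimpleGraph.IsTree.exists_twin_or_pendant_pair [Finite V] (hG : G.IsTree) (r : V)
    (hcard : 3 ≤ Nat.card V) :
    ∃ l u, l ≠ r ∧ (∀ x, G.Adj l x ↔ x = u) ∧
      ((∃ l', l' ≠ l ∧ l' ≠ r ∧ ∀ x, G.Adj l' x ↔ x = u) ∨
        (u ≠ r ∧ ∃ w, w ≠ l ∧ ∀ x, G.Adj u x ↔ x = l ∨ x = w)) := by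
  classical
  have := Fintype.ofFinite V
  rw [Nat.card_eq_fintype_card] at hcard
  have hnt : Nontrivial V := Fintype.one_lt_card_iff_nontrivial.1 (by omega)
  have hpos : ∀ x, x ≠ r → 0 < G.dist r x := fun x hx =>
    hG.connected.pos_dist_of_ne hx.symm
  have hstep : ∀ {v w}, G.Adj v w → G.dist r v = G.dist r w + 1 ∨ G.dist r w = G.dist r v + 1 :=
    fun h => hG.dist_eq_dist_add_one_of_adj r h
  obtain ⟨l, hl⟩ := Finite.exists_max fun x => G.dist r x
  have hparent : ∀ v, v ≠ r → ∃ w, G.Adj v w ∧ G.dist r v = G.dist r w + 1 := by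
    intro v hv
    obtain ⟨p, hp, hpl⟩ := hG.connected.exists_path_of_dist r v
    have hnil : ¬ p.Nil := SimpleGraph.Walk.not_nil_of_ne hv.symm
    refine ⟨p.penultimate, (p.adj_penultimate hnil).symm, ?_⟩
    have h1 := SimpleGraph.dist_le p.dropLast
    have h2 := p.length_dropLast_add_one hnil
    rcases hstep (p.adj_penultimate hnil) <;> omega
  have hlr : l ≠ r := by
    rintro rfl
    obtain ⟨x, hx⟩ := exists_ne l
    have := hl x
    have := hpos x hx
    simp only [SimpleGraph.dist_self] at *
    omega
  have hleaf : ∀ v w, G.dist r v = G.dist r l → v ≠ r → G.Adj v w →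
      G.dist r v = G.dist r w + 1 → ∀ x, G.Adj v x ↔ x = w := by
    intro v w hv hvr hvw hd x
    refine ⟨fun hx => ?_, fun hx => hx ▸ hvw⟩
    refine hG.eq_of_adj_of_dist_lt (r := r) hx hvw ?_ (by omega)
    rcases hstep hx with h | h
    · omega
    · have := hl x
      omega
  obtain ⟨u, hlu, hdu⟩ := hparent l hlr
  refine ⟨l, u, hlr, hleaf l u rfl hlr hlu hdu, ?_⟩
  -- Another child of `u` is as deep as `l`, hence also a leaf. Without one, `u` has only `l` and
  -- its parent as neighbours.
  by_cases htwin : ∃ l', l' ≠ l ∧ G.Adj u l' ∧ G.dist r l' = G.dist r u + 1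
  · obtain ⟨l', h1, h2, h3⟩ := htwin
    have hl'r : l' ≠ r := by
      rintro rfl
      simp at h3
    exact Or.inl ⟨l', h1, hl'r, hleaf l' u (by omega) hl'r h2.symm h3⟩
  · right
    push Not at htwin
    -- If `u` were the root, the maximal depth would be 1, and any third vertex would be a second
    -- child of `u`.
    have hur : u ≠ r := by
      rintro rfl
      obtain ⟨z, hz⟩ : ∃ z, z ∉ ({l, u} : Finset V) := by
        by_contra! h
        have := Finset.card_le_card (fun x _ => h x : (Finset.univ : Finset V) ⊆ {l, u})
        have := Finset.card_le_two (a := l) (b := u)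
        simp only [Finset.card_univ] at *
        omega
      simp only [Finset.mem_insert, Finset.mem_singleton, not_or] at hz
      have h1 := hl z
      have h2 := hpos z hz.2
      simp only [SimpleGraph.dist_self] at *
      have h3 : G.dist u z = 1 := by omega
      exact htwin z hz.1 (SimpleGraph.dist_eq_one_iff_adj.1 h3) h3
    obtain ⟨w, huw, hdw⟩ := hparent u hur
    refine ⟨hur, w, by rintro rfl; omega, fun x => ⟨fun hx => ?_, ?_⟩⟩
    · by_cases hxl : x = l
      · exact Or.inl hxl
      · right
        have := htwin x hxl hx
        refine hG.eq_of_adj_of_dist_lt (r := r) hx huw ?_ (by omega)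
        rcases hstep hx <;> omega
    · rintro (rfl | rfl)
      · exact hlu.symm
      · exact huw

variable [DecidableEq V]

/-- The decomposition of a connected vertex set of an acyclic graph. -/
lemma SimpleGraph.IsAcyclic.exists_decomposition (hG : G.IsAcyclic) {W : Finset V}
    (hW : (G.induce (W : Set V)).Connected) (hcard : 3 ≤ W.card) {r : V} (hr : r ∈ W) :
    (∃ l u l' W', W = insert l W' ∧ l ∉ W' ∧ u ∈ W' ∧ l' ∈ W' ∧ r ∈ W' ∧ l' ≠ u ∧
      (∀ x ∈ W', G.Adj l x ↔ x = u) ∧ (∀ x ∈ W', G.Adj l' x ↔ x = u) ∧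
      (G.induce (W' : Set V)).Connected) ∨
    (∃ l u w W', W = insert l (insert u W') ∧ u ∉ W' ∧ l ∉ insert u W' ∧ w ∈ W' ∧ r ∈ W' ∧
      (∀ x ∈ insert u W', G.Adj l x ↔ x = u) ∧ (∀ x ∈ W', G.Adj u x ↔ x = w) ∧
      (G.induce (W' : Set V)).Connected) := by
  have hT : (G.induce (W : Set V)).IsTree := ⟨hW, hG.induce _⟩
  obtain ⟨⟨l, hl⟩, ⟨u, hu⟩, hlr, hlu, h⟩ :=
    hT.exists_twin_or_pendant_pair ⟨r, hr⟩ (by simpa using hcard)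
  rw [Finset.mem_coe] at hl hu
  have hadj : ∀ x ∈ W, G.Adj l x ↔ x = u := fun x hx => by
    simpa using hlu ⟨x, hx⟩
  have hne : l ≠ u := ((hadj u hu).2 rfl).ne
  have hW' : W = insert l (W.erase l) := (Finset.insert_erase hl).symm
  have hlr' : l ≠ r := by simpa using hlr
  have hadj1 : ∀ x ∈ W.erase l, G.Adj l x ↔ x = u :=
    fun x hx => hadj x (Finset.mem_of_mem_erase hx)
  have hue : u ∈ W.erase l := Finset.mem_erase.2 ⟨hne.symm, hu⟩
  have hre : r ∈ W.erase l := Finset.mem_erase.2 ⟨hlr'.symm, hr⟩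
  have hconn : (G.induce ((W.erase l : Finset V) : Set V)).Connected :=
    connected_induce_of_insert (hW' ▸ hW) hue fun x hx => (hadj1 x hx).1
  rcases h with ⟨⟨l', hl'⟩, h1, h2, h3⟩ | ⟨hur, ⟨w, hw⟩, hwl, h⟩
  · left
    rw [Finset.mem_coe] at hl'
    have hadj' : ∀ x ∈ W, G.Adj l' x ↔ x = u := fun x hx => by
      simpa using h3 ⟨x, hx⟩
    exact ⟨l, u, l', W.erase l, hW', Finset.notMem_erase _ _, hue,
      Finset.mem_erase.2 ⟨by simpa using h1, hl'⟩, hre, ((hadj' u hu).2 rfl).ne, hadj1,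
      fun x hx => hadj' x (Finset.mem_of_mem_erase hx), hconn⟩
  · right
    rw [Finset.mem_coe] at hw
    have hadj' : ∀ x ∈ W, G.Adj u x ↔ x = l ∨ x = w := fun x hx => by
      simpa using h ⟨x, hx⟩
    have hWu : W.erase l = insert u ((W.erase l).erase u) := (Finset.insert_erase hue).symm
    have huw : u ≠ w := ((hadj' w hw).2 (Or.inr rfl)).ne
    have hwe : w ∈ (W.erase l).erase u :=
      Finset.mem_erase.2 ⟨huw.symm, Finset.mem_erase.2 ⟨by simpa using hwl, hw⟩⟩
    have hadj2 : ∀ x ∈ (W.erase l).erase u, G.Adj u x ↔ x = w := by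
      intro x hx
      simp only [Finset.mem_erase] at hx
      rw [hadj' x hx.2.2]
      simp [hx.2.1]
    refine ⟨l, u, w, (W.erase l).erase u, ?_, Finset.notMem_erase _ _, ?_, hwe, ?_, ?_, hadj2, ?_⟩
    · rw [← hWu, ← hW']
    · rw [← hWu]
      exact Finset.notMem_erase _ _
    · exact Finset.mem_erase.2 ⟨by simpa using Ne.symm hur, hre⟩
    · rwa [← hWu]
    · exact connected_induce_of_insert (hWu ▸ hconn) hwe fun x hx => (hadj2 x hx).1

end Structure

/-! ### Spiders and the inductive bounds -/

section Spider

variable {V : Type*} {G : SimpleGraph V} {W : Finset V} {a k : ℕ} {r : V}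

/-- `W` is covered by `r`, by neighbours `x 0, …, x (a - 1)` of `r`, and by neighbours `y j` of
`x j` for `j < k`. -/
def IsSpiderAt (G : SimpleGraph V) (W : Finset V) (a k : ℕ) (r : V) : Prop :=
  ∃ x y : ℕ → V, (∀ v ∈ W, v = r ∨ (∃ i < a, v = x i) ∨ ∃ j < k, v = y j) ∧
    (∀ i < a, G.Adj r (x i)) ∧ ∀ j < k, G.Adj (x j) (y j)

/-- The sharp bound for the number of connected sets through `r`. -/
def RootBound (G : SimpleGraph V) (W : Finset V) (a k : ℕ) (r : V) : Prop :=
  connCount G W {r} ≤ 2 ^ (a - k) * 3 ^ k ∧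
    (connCount G W {r} = 2 ^ (a - k) * 3 ^ k → IsSpiderAt G W a k r)

/-- The sharp bound for the number of all connected sets. -/
def TotalBound (G : SimpleGraph V) (W : Finset V) (a k : ℕ) : Prop :=
  connCount G W ∅ ≤ 2 ^ (a - k) * 3 ^ k + a + 2 * k ∧
    (connCount G W ∅ = 2 ^ (a - k) * 3 ^ k + a + 2 * k → ∃ r ∈ W, IsSpiderAt G W a k r)

variable [DecidableEq V]

lemma IsSpiderAt.insert_leaf {l : V} (h : IsSpiderAt G W a k r) (hka : k ≤ a) (hl : G.Adj r l) :
    IsSpiderAt G (insert l W) (a + 1) k r := by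
  obtain ⟨x, y, h1, h2, h3⟩ := h
  refine ⟨Function.update x a l, y, ?_, ?_, ?_⟩
  · intro v hv
    rcases Finset.mem_insert.1 hv with rfl | hv
    · exact Or.inr (Or.inl ⟨a, by omega, by simp⟩)
    · rcases h1 v hv with h | ⟨i, hi, h⟩ | h
      · exact Or.inl h
      · exact Or.inr (Or.inl ⟨i, by omega, by rw [Function.update_of_ne (by omega), h]⟩)
      · exact Or.inr (Or.inr h)
  · intro i hi
    by_cases hia : i = a
    · subst hia
      simpa using hl
    · rw [Function.update_of_ne hia]
      exact h2 i (by omega)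
  · intro j hj
    rw [Function.update_of_ne (by omega)]
    exact h3 j hj

lemma IsSpiderAt.insert_pair {l u : V} (h : IsSpiderAt G W a k r) (hka : k < a) (hu : G.Adj r u)
    (hl : G.Adj u l) : IsSpiderAt G (insert l (insert u W)) (a + 1) (k + 1) r := by
  obtain ⟨x, y, h1, h2, h3⟩ := h
  -- Legs of length two must occupy the first indices, so the short leg at index `k` moves to the
  -- free index `a` and the new long leg takes its place.
  refine ⟨Function.update (Function.update x a (x k)) k u, Function.update y k l, ?_, ?_, ?_⟩
  · intro v hv
    rcases Finset.mem_insert.1 hv with rfl | hv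
    · exact Or.inr (Or.inr ⟨k, by omega, by simp⟩)
    rcases Finset.mem_insert.1 hv with rfl | hv
    · exact Or.inr (Or.inl ⟨k, by omega, by simp⟩)
    · rcases h1 v hv with h | ⟨i, hi, h⟩ | ⟨j, hj, h⟩
      · exact Or.inl h
      · right
        left
        by_cases hik : i = k
        · refine ⟨a, by omega, ?_⟩
          rw [Function.update_of_ne (by omega), Function.update_self, h, hik]
        · refine ⟨i, by omega, ?_⟩
          rw [Function.update_of_ne hik, Function.update_of_ne (by omega), h]
      · exact Or.inr (Or.inr ⟨j, by omega, by rw [Function.update_of_ne (by omega), h]⟩)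
  · intro i hi
    by_cases hik : i = k
    · subst hik
      simpa using hu
    · rw [Function.update_of_ne hik]
      by_cases hia : i = a
      · subst hia
        simpa using h2 k hka
      · rw [Function.update_of_ne hia]
        exact h2 i (by omega)
  · intro j hj
    by_cases hjk : j = k
    · subst hjk
      simpa using hl
    · rw [Function.update_of_ne hjk, Function.update_of_ne (by omega),
        Function.update_of_ne hjk]
      exact h3 j (by omega)

lemma isSpiderAt_pair {s : V} (h : G.Adj r s) : IsSpiderAt G {r, s} 1 0 r :=
  ⟨fun _ => s, fun _ => s, by simp, by simp [h], by simp⟩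

section Twin

variable {l u : V} (hl : l ∉ W) (hu : u ∈ W) (hka : k < a)
  (hadj : ∀ x ∈ W, G.Adj l x ↔ x = u)
include hl hu hka hadj

/-- The added sets correspond to old sets through both `r` and `u`, so the count at most doubles.
Equality makes every old set through `r`, in particular `{r}`, contain `u`, so the leaf hangs from
`r`. -/
lemma RootBound.insert_leaf (hr : r ∈ W) (h : RootBound G W a k r) :
    RootBound G (insert l W) (a + 1) k r := by
  have hc := connCount_insert_singleton hl hu hr hadj
  have hle := connCount_anti_right (G := G) (W := W) (Finset.subset_insert u {r})
  have hpow : 2 ^ (a + 1 - k) * 3 ^ k = 2 * (2 ^ (a - k) * 3 ^ k) := by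
    rw [Nat.succ_sub hka.le, pow_succ]
    ring
  unfold RootBound
  rw [hpow, hc]
  refine ⟨by have := h.1; omega, fun he => ?_⟩
  have h1 := h.1
  have hur : u = r := mem_of_connCount_eq (G := G) hr (by omega)
  subst hur
  exact (h.2 (by omega)).insert_leaf hka.le ((hadj u hu).2 rfl).symm

/-- Equality forces equality in the rooted bound at `u`, and this alone puts the centre of the
spider at `u`; the equality clause of the old total bound plays no role. -/
lemma TotalBound.insert_leaf (hr : RootBound G W a k u) (h : TotalBound G W a k) :
    TotalBound G (insert l W) (a + 1) k := by
  have hc := connCount_insert_empty hl hu hadj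
  have hpow : 2 ^ (a + 1 - k) * 3 ^ k = 2 * (2 ^ (a - k) * 3 ^ k) := by
    rw [Nat.succ_sub hka.le, pow_succ]
    ring
  unfold TotalBound
  rw [hpow, hc]
  have h1 := h.1
  have h2 := hr.1
  refine ⟨by omega, fun he => ⟨u, Finset.mem_insert_of_mem hu, ?_⟩⟩
  exact (hr.2 (by omega)).insert_leaf hka.le ((hadj u hu).2 rfl).symm

end Twin

section Pair

variable {l u w : V} (hu : u ∉ W) (hl : l ∉ insert u W) (hw : w ∈ W) (hka : k < a)
  (hadjl : ∀ x ∈ insert u W, G.Adj l x ↔ x = u) (hadju : ∀ x ∈ W, G.Adj u x ↔ x = w)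
include hu hl hw hka hadjl hadju

lemma RootBound.insert_pair (hr : r ∈ W) (h : RootBound G W a k r) :
    RootBound G (insert l (insert u W)) (a + 1) (k + 1) r := by
  have hc := connCount_insert_pair_singleton hu hl hw hadjl hadju hr
  have hle := connCount_anti_right (G := G) (W := W) (Finset.subset_insert w {r})
  have hpow : 2 ^ (a + 1 - (k + 1)) * 3 ^ (k + 1) = 3 * (2 ^ (a - k) * 3 ^ k) := by
    rw [Nat.add_sub_add_right, pow_succ]
    ring
  unfold RootBound
  rw [hpow, hc]
  refine ⟨by have := h.1; omega, fun he => ?_⟩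
  have h1 := h.1
  have hwr : w = r := mem_of_connCount_eq (G := G) hr (by omega)
  subst hwr
  exact (h.2 (by omega)).insert_pair hka ((hadju w hw).2 rfl).symm
    ((hadjl u (Finset.mem_insert_self _ _)).2 rfl).symm

lemma TotalBound.insert_pair (hr : RootBound G W a k w) (h : TotalBound G W a k) :
    TotalBound G (insert l (insert u W)) (a + 1) (k + 1) := by
  have hc := connCount_insert_pair_empty hu hl hw hadjl hadju
  have hpow : 2 ^ (a + 1 - (k + 1)) * 3 ^ (k + 1) = 3 * (2 ^ (a - k) * 3 ^ k) := by
    rw [Nat.add_sub_add_right, pow_succ]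
    ring
  unfold TotalBound
  rw [hpow, hc]
  have h1 := h.1
  have h2 := hr.1
  refine ⟨by omega, fun he => ⟨w, by simp [hw], ?_⟩⟩
  exact (hr.2 (by omega)).insert_pair hka ((hadju w hw).2 rfl).symm
    ((hadjl u (Finset.mem_insert_self _ _)).2 rfl).symm

end Pair

lemma connCount_pair {s : V} (h : G.Adj r s) :
    connCount G {r, s} ∅ = 3 ∧ connCount G {r, s} {r} = 2 := by
  have hadj : ∀ x ∈ ({r} : Finset V), G.Adj s x ↔ x = r := by simp [h.symm]
  have hs : s ∉ ({r} : Finset V) := by simp [h.ne']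
  rw [Finset.pair_comm r s]
  rw [connCount_insert_empty hs (Finset.mem_singleton_self r) hadj,
    connCount_insert_singleton hs (Finset.mem_singleton_self r) (Finset.mem_singleton_self r) hadj]
  simp [connCount_singleton]

omit [DecidableEq V] in
lemma adj_of_induce_pair_connected {s : V} (h : (G.induce ({r, s} : Set V)).Connected)
    (hrs : r ≠ s) : G.Adj r s := by
  have : Nontrivial ({r, s} : Set V) := ⟨⟨r, by simp⟩, ⟨s, by simp⟩, by simpa using hrs⟩
  obtain ⟨⟨t, ht⟩, hrt⟩ := h.preconnected.exists_adj_of_nontrivial ⟨r, by simp⟩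
  have hrt' : G.Adj r t := hrt
  rcases ht with rfl | ht
  · exact absurd rfl hrt'.ne
  · exact Set.mem_singleton_iff.1 ht ▸ hrt'

lemma exists_adj_of_card_eq_two (hW : (G.induce (W : Set V)).Connected) (hc : W.card = 2)
    (hr : r ∈ W) : ∃ s, W = {r, s} ∧ G.Adj r s := by
  obtain ⟨s, hs⟩ : ∃ s, W.erase r = {s} :=
    Finset.card_eq_one.1 (by rw [Finset.card_erase_of_mem hr, hc])
  have hWrs : W = {r, s} := by rw [← Finset.insert_erase hr, hs]
  refine ⟨s, hWrs, ?_⟩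
  subst hWrs
  have hrs : r ≠ s := by
    rintro rfl
    simp at hc
  exact adj_of_induce_pair_connected (by rwa [Finset.coe_pair] at hW) hrs

omit [DecidableEq V] in
lemma indepOn_singleton (v : V) : indepOn G {v} = 1 := by
  refine le_antisymm ?_ (card_le_indepOn (S := {v}) subset_rfl (by simp))
  obtain ⟨S, hS, -, hc⟩ := exists_card_eq_indepOn G {v}
  exact hc ▸ Finset.card_le_card hS

section Path

variable {l u w : V} (hu : u ∉ ({w} : Finset V)) (hl : l ∉ insert u ({w} : Finset V))
  (hadjl : ∀ x ∈ insert u ({w} : Finset V), G.Adj l x ↔ x = u)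
  (hadju : ∀ x ∈ ({w} : Finset V), G.Adj u x ↔ x = w)
include hu hl hadjl hadju

/-- Deleting the pair leaves one vertex, for which no `k ≥ 0` satisfies the cardinality relation, so
this path is a separate base case. At the end `w` the count is 3 < 4, and the equality clause is
vacuous. -/
lemma rootBound_path : RootBound G (insert l (insert u {w})) 2 0 w := by
  have hc := connCount_insert_pair_singleton hu hl (Finset.mem_singleton_self w) hadjl hadju
    (Finset.mem_singleton_self w)
  rw [Finset.insert_eq_of_mem (Finset.mem_singleton_self w), (connCount_singleton w).2] at hc
  unfold RootBound
  rw [hc]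
  simp

lemma totalBound_path : TotalBound G (insert l (insert u {w})) 2 0 := by
  have hc := connCount_insert_pair_empty hu hl (Finset.mem_singleton_self w) hadjl hadju
  rw [(connCount_singleton w).1, (connCount_singleton w).2] at hc
  unfold TotalBound
  rw [hc]
  refine ⟨by simp, fun _ => ⟨u, by simp, ?_⟩⟩
  have h := (isSpiderAt_pair ((hadju w (Finset.mem_singleton_self w)).2 rfl)).insert_leaf
    (Nat.zero_le _) ((hadjl u (Finset.mem_insert_self _ _)).2 rfl).symm
  exact h

end Path

/-- The bounds for every connected vertex set `W` with at least two vertices in a forest. -/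
theorem SimpleGraph.IsAcyclic.bounds (hG : G.IsAcyclic) {m : ℕ} :
    ∀ W : Finset V, W.card = m → 2 ≤ m → (G.induce (W : Set V)).Connected →
    ∃ k, W.card = indepOn G W + 1 + k ∧ k < indepOn G W ∧
      (∀ r ∈ W, RootBound G W (indepOn G W) k r) ∧ TotalBound G W (indepOn G W) k := by
  induction m using Nat.strong_induction_on with
  | _ m ih =>
  intro W hm h2 hW
  rcases h2.eq_or_lt with hm2 | hm3
  · have hind : indepOn G W = 1 := by
      obtain ⟨r, hr⟩ := Finset.card_pos.1 (by omega : 0 < W.card)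
      obtain ⟨s, rfl, hs⟩ := exists_adj_of_card_eq_two hW (by omega) hr
      exact indepOn_pair hs
    rw [hind]
    have hroot : ∀ r ∈ W, (connCount G W ∅ = 3 ∧ connCount G W {r} = 2) ∧
        IsSpiderAt G W 1 0 r := by
      intro r hr
      obtain ⟨s, rfl, hs⟩ := exists_adj_of_card_eq_two hW (by omega) hr
      exact ⟨connCount_pair hs, isSpiderAt_pair hs⟩
    obtain ⟨r, hr⟩ := Finset.card_pos.1 (by omega : 0 < W.card)
    refine ⟨0, by omega, by omega, fun r hr => ⟨?_, fun _ => (hroot r hr).2⟩, ?_,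
      fun _ => ⟨r, hr, (hroot r hr).2⟩⟩
    · simp [(hroot r hr).1.2]
    · simp [(hroot r hr).1.1]
  -- The deleted vertices depend on `r`, which must survive the deletion. The resulting `k` does
  -- not, since the cardinality of `W` determines it.
  · have key : ∀ r ∈ W, ∃ k, W.card = indepOn G W + 1 + k ∧ k < indepOn G W ∧
        RootBound G W (indepOn G W) k r ∧ TotalBound G W (indepOn G W) k := by
      intro r hr
      rcases hG.exists_decomposition hW (by omega) hr with
        ⟨l, u, l', W', rfl, hl, hu, hl', hr', hlu, hadj, hadj', hW'⟩ |
        ⟨l, u, w, W', rfl, hu, hl, hw, hr', hadjl, hadju, hW'⟩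
      · rw [Finset.card_insert_of_notMem hl] at hm ⊢
        obtain ⟨k, h1, h2, h3, h4⟩ := ih W'.card (by omega) W' rfl (by omega) hW'
        rw [indepOn_insert_of_twin hl hl' hlu hadj hadj']
        exact ⟨k, by omega, by omega, (h3 r hr').insert_leaf hl hu h2 hadj hr',
          h4.insert_leaf hl hu h2 hadj (h3 u hu)⟩
      · have hcard : (insert l (insert u W')).card = W'.card + 2 := by
          rw [Finset.card_insert_of_notMem hl, Finset.card_insert_of_notMem hu]
        rw [hcard] at hm ⊢
        have hpos := Finset.card_pos.2 ⟨w, hw⟩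
        rcases Nat.eq_or_lt_of_le hpos with h1 | hle
        · obtain ⟨v, rfl⟩ := Finset.card_eq_one.1 (Eq.symm h1)
          obtain rfl := Finset.mem_singleton.1 hw
          obtain rfl := Finset.mem_singleton.1 hr'
          rw [indepOn_insert_pair hl hadjl hu, indepOn_singleton]
          exact ⟨0, by simp, by simp, rootBound_path hu hl hadjl hadju,
            totalBound_path hu hl hadjl hadju⟩
        obtain ⟨k, h1, h2, h3, h4⟩ := ih W'.card (by omega) W' rfl hle hW'
        rw [indepOn_insert_pair hl hadjl hu]
        exact ⟨k + 1, by omega, by omega, (h3 r hr').insert_pair hu hl hw h2 hadjl hadju hr',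
          h4.insert_pair hu hl hw h2 hadjl hadju (h3 w hw)⟩
    obtain ⟨r, hr⟩ := Finset.card_pos.1 (by omega : 0 < W.card)
    obtain ⟨k, h1, h2, -, h4⟩ := key r hr
    refine ⟨k, h1, h2, fun s hs => ?_, h4⟩
    obtain ⟨k', h1', -, h3', -⟩ := key s hs
    obtain rfl : k = k' := by omega
    exact h3'

end Spider

/-! ### The star with pendant edges: tree, independence number, count -/

section StarWithPendants

open SimpleGraph

variable {a k : ℕ}

lemma starWithPendants_adj_center_leaf {c : Unit} (i : Fin a) :
    (starWithPendants a k).Adj (.inl c) (.inr (.inl i)) := by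
  simp [starWithPendants]

lemma starWithPendants_adj_leaf_pendant {i : Fin a} {j : Fin k} :
    (starWithPendants a k).Adj (.inr (.inl i)) (.inr (.inr j)) ↔ (i : ℕ) = j := by
  simp [starWithPendants]

lemma starWithPendants_not_adj_center_pendant {c : Unit} (j : Fin k) :
    ¬ (starWithPendants a k).Adj (.inl c) (.inr (.inr j)) := by
  simp [starWithPendants]

lemma starWithPendants_not_adj_leaf_leaf (i i' : Fin a) :
    ¬ (starWithPendants a k).Adj (.inr (.inl i)) (.inr (.inl i')) := by
  simp [starWithPendants]

lemma starWithPendants_not_adj_pendant_pendant (j j' : Fin k) :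
    ¬ (starWithPendants a k).Adj (.inr (.inr j)) (.inr (.inr j')) := by
  simp [starWithPendants]

lemma starWithPendants_connected (hka : k ≤ a) : (starWithPendants a k).Connected := by
  have hx : ∀ i, (starWithPendants a k).Reachable (.inl ()) (.inr (.inl i)) :=
    fun i => (starWithPendants_adj_center_leaf i).reachable
  refine connected_iff_exists_forall_reachable _ |>.2 ⟨.inl (), ?_⟩
  rintro (_ | i | j)
  · exact Reachable.refl _
  · exact hx i
  · exact (hx (j.castLE hka)).trans
      (starWithPendants_adj_leaf_pendant.2 (by simp)).reachable

lemma starWithPendants_card : Nat.card (Unit ⊕ Fin a ⊕ Fin k) = a + 1 + k := by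
  simp
  ring

lemma starWithPendants_isTree (hka : k ≤ a) : (starWithPendants a k).IsTree := by
  have hconn := starWithPendants_connected hka
  refine isTree_iff_connected_and_card.2 ⟨hconn, le_antisymm ?_ ?_⟩
  · let f : Fin a ⊕ Fin k → Sym2 (Unit ⊕ Fin a ⊕ Fin k) := Sum.elim
      (fun i => s(.inl (), .inr (.inl i)))
      (fun j => s(.inr (.inl (j.castLE hka)), .inr (.inr j)))
    have hsub : (starWithPendants a k).edgeSet ⊆ Set.range f := by
      have hcl : ∀ i : Fin a, s(.inl (), .inr (.inl i)) ∈ Set.range f :=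
        fun i => ⟨.inl i, rfl⟩
      have hlp : ∀ (i : Fin a) (j : Fin k), (i : ℕ) = j →
          s(.inr (.inl i), .inr (.inr j)) ∈ Set.range f := by
        intro i j h
        refine ⟨.inr j, ?_⟩
        have : j.castLE hka = i := Fin.ext h.symm
        simp [f, this]
      intro e
      induction e using Sym2.ind with
      | _ p q =>
      rw [mem_edgeSet]
      rcases p with _ | i | j <;> rcases q with _ | i' | j' <;> intro h
      · exact absurd rfl h.ne
      · exact hcl i'
      · exact absurd h (starWithPendants_not_adj_center_pendant _)
      · exact Sym2.eq_swap ▸ hcl i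
      · exact absurd h (starWithPendants_not_adj_leaf_leaf _ _)
      · exact hlp i j' (starWithPendants_adj_leaf_pendant.1 h)
      · exact absurd h.symm (starWithPendants_not_adj_center_pendant _)
      · exact Sym2.eq_swap ▸ hlp i' j (starWithPendants_adj_leaf_pendant.1 h.symm)
      · exact absurd h (starWithPendants_not_adj_pendant_pendant _ _)
    have h1 := Set.ncard_le_ncard hsub (Set.toFinite _)
    have h2 : (Set.range f).ncard ≤ a + k := by
      rw [← Set.image_univ]
      refine (Set.ncard_image_le (Set.toFinite _)).trans ?_
      simp [Set.ncard_univ]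
    rw [starWithPendants_card]
    rw [← Nat.card_coe_set_eq] at h1
    omega
  · exact hconn.card_vert_le_card_edgeSet_add_one

/-- A tree covered by a spider with the right number of vertices is the spider. -/
lemma SimpleGraph.IsTree.nonempty_iso_starWithPendants {V : Type*} [Fintype V]
    {T : SimpleGraph V} (hT : T.IsTree) (hka : k ≤ a) (hcard : Fintype.card V = a + 1 + k)
    {r : V} (h : IsSpiderAt T Finset.univ a k r) : Nonempty (T ≃g starWithPendants a k) := by
  obtain ⟨x, y, h1, h2, h3⟩ := h
  let f : Unit ⊕ Fin a ⊕ Fin k → V :=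
    Sum.elim (fun _ => r) (Sum.elim (fun i => x i) (fun j => y j))
  have hsurj : Function.Surjective f := by
    intro v
    rcases h1 v (Finset.mem_univ v) with rfl | ⟨i, hi, rfl⟩ | ⟨j, hj, rfl⟩
    · exact ⟨.inl (), rfl⟩
    · exact ⟨.inr (.inl ⟨i, hi⟩), rfl⟩
    · exact ⟨.inr (.inr ⟨j, hj⟩), rfl⟩
  have hbij : Function.Bijective f :=
    (Fintype.bijective_iff_surjective_and_card f).2 ⟨hsurj, by
      rw [hcard, ← starWithPendants_card, Nat.card_eq_fintype_card]⟩
  let e := Equiv.ofBijective f hbij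
  have iso : T.comap e ≃g T := Iso.comap e T
  have htree : (T.comap e).IsTree := iso.isTree_iff.2 hT
  have hle : starWithPendants a k ≤ T.comap e := by
    intro p q h
    change T.Adj (f p) (f q)
    rcases p with _ | i | j <;> rcases q with _ | i' | j'
    · exact absurd rfl h.ne
    · exact h2 _ i'.2
    · exact absurd h (starWithPendants_not_adj_center_pendant _)
    · exact (h2 _ i.2).symm
    · exact absurd h (starWithPendants_not_adj_leaf_leaf _ _)
    · have := starWithPendants_adj_leaf_pendant.1 h
      simpa [f, this] using h3 _ j'.2
    · exact absurd h.symm (starWithPendants_not_adj_center_pendant _)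
    · have := starWithPendants_adj_leaf_pendant.1 h.symm
      simpa [f, this] using (h3 _ j.2).symm
    · exact absurd h (starWithPendants_not_adj_pendant_pendant _ _)
  -- A tree has no proper connected spanning subgraph.
  have heq : starWithPendants a k = T.comap e :=
    le_antisymm hle ((isTree_iff_minimal_connected.1 htree).2 (starWithPendants_connected hka) hle)
  rw [heq]
  exact ⟨iso.symm⟩

/-- The vertices split into `a` cliques, namely the legs, with the centre joined to the last one,
which has no pendant because `k < a`. An independent set meets each clique at most once; the tips of
the legs attain `a`. -/
lemma starWithPendants_indepNum (hka : k < a) : (starWithPendants a k).indepNum = a := by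
  refine le_antisymm ?_ ?_
  · obtain ⟨S, hS⟩ := (starWithPendants a k).exists_isNIndepSet_indepNum
    let f : Unit ⊕ Fin a ⊕ Fin k → Fin a :=
      Sum.elim (fun _ => ⟨a - 1, by omega⟩) (Sum.elim id (fun j => j.castLE hka.le))
    have hinj : Set.InjOn f S := by
      have hS' : ∀ p ∈ S, ∀ q ∈ S, ¬ (starWithPendants a k).Adj p q := by
        intro p hp q hq h
        exact hS.isIndepSet hp hq h.ne h
      intro p hp q hq h
      rw [Finset.mem_coe] at hp hq
      have hpq := hS' p hp q hq
      have hqp := hS' q hq p hp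
      rcases p with _ | i | j <;> rcases q with _ | i' | j' <;>
        simp only [f, Sum.elim_inl, Sum.elim_inr, id, Fin.ext_iff, Fin.val_castLE] at h
      · rfl
      · exact absurd (starWithPendants_adj_center_leaf _) hpq
      · have := j'.2
        omega
      · exact absurd (starWithPendants_adj_center_leaf _) hqp
      · rw [Fin.ext h]
      · exact absurd (starWithPendants_adj_leaf_pendant.2 h) hpq
      · have := j.2
        omega
      · exact absurd (starWithPendants_adj_leaf_pendant.2 h.symm) hqp
      · rw [Fin.ext h]
    rw [← hS.card_eq, ← Finset.card_image_of_injOn hinj]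
    exact (Finset.card_le_univ _).trans (by simp)
  · let f : Fin a → Unit ⊕ Fin a ⊕ Fin k := fun i =>
      if h : (i : ℕ) < k then .inr (.inr ⟨i, h⟩) else .inr (.inl i)
    have hinj : Function.Injective f := by
      intro i i' h
      by_cases h1 : (i : ℕ) < k <;> by_cases h2 : (i' : ℕ) < k <;>
        simp [f, h1, h2] at h
      · exact Fin.ext h
      · exact h
    have : (starWithPendants a k).IsIndepSet ((Finset.univ.image f : Finset _) : Set _) := by
      intro p hp q hq _
      simp only [Finset.coe_image, Finset.coe_univ, Set.image_univ, Set.mem_range] at hp hq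
      obtain ⟨i, rfl⟩ := hp
      obtain ⟨i', rfl⟩ := hq
      by_cases h1 : (i : ℕ) < k <;> by_cases h2 : (i' : ℕ) < k <;>
        simp only [f, h1, h2, dite_true, dite_false]
      · exact starWithPendants_not_adj_pendant_pendant _ _
      · rw [adj_comm, starWithPendants_adj_leaf_pendant]
        intro h
        simp only at h
        omega
      · rw [starWithPendants_adj_leaf_pendant]
        intro h
        simp only at h
        omega
      · exact starWithPendants_not_adj_leaf_leaf _ _
    have h := this.card_le_indepNum
    rwa [Finset.card_image_of_injective _ hinj, Finset.card_univ, Fintype.card_fin] at h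

open Classical in
/-- The centre, the leaves `i < b` and the pendant vertices `j < b` of `starWithPendants a k`. -/
noncomputable def starPart (a k b : ℕ) : Finset (Unit ⊕ Fin a ⊕ Fin k) :=
  Finset.univ.filter fun v =>
    Sum.elim (fun _ : Unit => True) (Sum.elim (fun i : Fin a => (i : ℕ) < b)
      (fun j : Fin k => (j : ℕ) < b)) v

lemma center_mem_starPart {c : Unit} (b : ℕ) : (.inl c : Unit ⊕ Fin a ⊕ Fin k) ∈ starPart a k b := by
  simp [starPart]

lemma leaf_mem_starPart {b : ℕ} {i : Fin a} :
    (.inr (.inl i) : Unit ⊕ Fin a ⊕ Fin k) ∈ starPart a k b ↔ (i : ℕ) < b := by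
  simp [starPart]

lemma pendant_mem_starPart {b : ℕ} {j : Fin k} :
    (.inr (.inr j) : Unit ⊕ Fin a ⊕ Fin k) ∈ starPart a k b ↔ (j : ℕ) < b := by
  simp [starPart]

lemma starPart_zero : starPart a k 0 = {.inl ()} := by
  ext (⟨⟩ | i | j)
  · simp [center_mem_starPart]
  · simp [leaf_mem_starPart]
  · simp [pendant_mem_starPart]

lemma starPart_self (hka : k ≤ a) : starPart a k a = Finset.univ := by
  ext (⟨⟩ | i | j)
  · simp [center_mem_starPart]
  · simp [leaf_mem_starPart]
  · simp [pendant_mem_starPart, j.2.trans_le hka]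

lemma starPart_succ_of_lt {b : ℕ} (hb : b < k) (hba : b < a) : starPart a k (b + 1) =
    insert (.inr (.inr ⟨b, hb⟩)) (insert (.inr (.inl ⟨b, hba⟩)) (starPart a k b)) := by
  ext (⟨⟩ | i | j)
  · simp [center_mem_starPart]
  · simp [leaf_mem_starPart, Fin.ext_iff]
    omega
  · simp [pendant_mem_starPart, Fin.ext_iff]
    omega

lemma starPart_succ_of_le {b : ℕ} (hb : k ≤ b) (hba : b < a) : starPart a k (b + 1) =
    insert (.inr (.inl ⟨b, hba⟩)) (starPart a k b) := by
  ext (⟨⟩ | i | j)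
  · simp [center_mem_starPart]
  · simp [leaf_mem_starPart, Fin.ext_iff]
    omega
  · simp [pendant_mem_starPart]
    omega

lemma adj_leaf_iff_of_mem_starPart {b : ℕ} (hba : b < a) :
    ∀ x ∈ starPart a k b,
      (starWithPendants a k).Adj (.inr (.inl ⟨b, hba⟩)) x ↔ x = .inl () := by
  rintro (⟨⟩ | i | j) hx
  · simp [(starWithPendants_adj_center_leaf _).symm]
  · simp [starWithPendants_not_adj_leaf_leaf]
  · rw [pendant_mem_starPart] at hx
    simp [starWithPendants_adj_leaf_pendant]
    omega

lemma adj_pendant_iff_of_mem_starPart {b : ℕ} (hb : b < k) (hba : b < a) :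
    ∀ x ∈ insert (.inr (.inl ⟨b, hba⟩)) (starPart a k b),
      (starWithPendants a k).Adj (.inr (.inr ⟨b, hb⟩)) x ↔ x = .inr (.inl ⟨b, hba⟩) := by
  rintro (⟨⟩ | i | j) hx
  · rw [adj_comm]
    simp [starWithPendants_not_adj_center_pendant]
  · rw [adj_comm, starWithPendants_adj_leaf_pendant]
    simp [Fin.ext_iff]
  · simp [starWithPendants_not_adj_pendant_pendant]

/-- The star is built leg by leg, long legs first. Each piece hangs from the centre, so every long
leg exactly triples the rooted count, and later every short leg doubles it. -/
lemma connCount_starPart_of_le {b : ℕ} (hb : b ≤ k) (hka : k ≤ a) :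
    connCount (starWithPendants a k) (starPart a k b) {.inl ()} = 3 ^ b ∧
      connCount (starWithPendants a k) (starPart a k b) ∅ = 3 ^ b + 3 * b := by
  induction b with
  | zero => simp [starPart_zero, connCount_singleton]
  | succ b ih =>
    obtain ⟨h1, h2⟩ := ih (by omega)
    have hba : b < a := by omega
    have hu : (.inr (.inl ⟨b, hba⟩) : Unit ⊕ Fin a ⊕ Fin k) ∉ starPart a k b := by
      simp [leaf_mem_starPart]
    have hl : (.inr (.inr ⟨b, hb⟩) : Unit ⊕ Fin a ⊕ Fin k) ∉
        insert (.inr (.inl ⟨b, hba⟩)) (starPart a k b) := by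
      simp [pendant_mem_starPart]
    have hc := center_mem_starPart (a := a) (k := k) (c := ()) b
    rw [starPart_succ_of_lt hb hba,
      connCount_insert_pair_singleton hu hl hc (adj_pendant_iff_of_mem_starPart hb hba)
        (adj_leaf_iff_of_mem_starPart hba) hc,
      connCount_insert_pair_empty hu hl hc (adj_pendant_iff_of_mem_starPart hb hba)
        (adj_leaf_iff_of_mem_starPart hba),
      Finset.insert_eq_of_mem (Finset.mem_singleton_self _), h1, h2]
    constructor <;> ring

lemma connCount_starPart_add {b : ℕ} (hba : k + b ≤ a) :
    connCount (starWithPendants a k) (starPart a k (k + b)) {.inl ()} = 2 ^ b * 3 ^ k ∧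
      connCount (starWithPendants a k) (starPart a k (k + b)) ∅ = 2 ^ b * 3 ^ k + b + 3 * k := by
  induction b with
  | zero =>
    have := connCount_starPart_of_le le_rfl (show k ≤ a by omega)
    simpa using this
  | succ b ih =>
    obtain ⟨h1, h2⟩ := ih (by omega)
    have hba' : k + b < a := by omega
    have hu : (.inr (.inl ⟨k + b, hba'⟩) : Unit ⊕ Fin a ⊕ Fin k) ∉ starPart a k (k + b) := by
      simp [leaf_mem_starPart]
    have hc := center_mem_starPart (a := a) (k := k) (c := ()) (k + b)
    rw [← add_assoc, starPart_succ_of_le (Nat.le_add_right _ _) hba',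
      connCount_insert_singleton hu hc hc (adj_leaf_iff_of_mem_starPart hba'),
      connCount_insert_empty hu hc (adj_leaf_iff_of_mem_starPart hba'),
      Finset.insert_eq_of_mem (Finset.mem_singleton_self _), h1, h2]
    constructor <;> ring

lemma connCount_starWithPendants (hka : k ≤ a) :
    connCount (starWithPendants a k) Finset.univ ∅ = 2 ^ (a - k) * 3 ^ k + a + 2 * k := by
  have h := (connCount_starPart_add (a := a) (k := k) (b := a - k) (by omega)).2
  rw [Nat.add_sub_cancel' hka, starPart_self hka] at h
  omega

end StarWithPendants

/-! ### The breadth-first tree -/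

section ExtremalTree

open SimpleGraph

variable {n a k : ℕ}

lemma sum_Iic_starSeq (h : a + 1 + k = n) (i : Fin n) :
    ∑ l ∈ Finset.Iic i, starSeq n a l = a + i + min (i : ℕ) k := by
  obtain ⟨i, hi⟩ := i
  induction i with
  | zero =>
    have : Finset.Iic (⟨0, hi⟩ : Fin n) = {⟨0, hi⟩} := by
      ext l
      simp [Fin.le_def, Fin.ext_iff]
    simp [this, starSeq]
  | succ i ih =>
    have : Finset.Iic (⟨i + 1, hi⟩ : Fin n) =
        insert ⟨i + 1, hi⟩ (Finset.Iic ⟨i, by omega⟩) := by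
      ext l
      simp [Fin.le_def, Fin.ext_iff]
      omega
    rw [this, Finset.sum_insert (by simp [Fin.le_def]), ih]
    simp only [starSeq, Nat.add_eq_zero_iff, one_ne_zero, and_false, if_false]
    by_cases hik : i + 1 ≤ k
    · rw [if_pos (by omega), min_eq_left hik, min_eq_left (by omega)]
      ring
    · rw [if_neg (by omega), min_eq_right (by omega), min_eq_right (by omega)]
      ring

/-- In `T*_α` the parent of the vertex `j > 0` is `j - α` (truncated subtraction). -/
lemma extremalTree_adj (h : a + 1 + k = n) (hka : k < a) {i j : Fin n} :
    (extremalTree n a).Adj i j ↔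
      (0 < (j : ℕ) ∧ (i : ℕ) = j - a) ∨ (0 < (i : ℕ) ∧ (j : ℕ) = i - a) := by
  have key : ∀ i j : Fin n, (0 < (j : ℕ) ∧
      IsLeast {k : Fin n | (j : ℕ) + (k : ℕ) ≤ ∑ l ∈ Finset.Iic k, starSeq n a l} i) ↔
        (0 < (j : ℕ) ∧ (i : ℕ) = j - a) := by
    intro i j
    refine and_congr_right fun hj => ?_
    -- By the formula for the partial sums the condition on `l` is `j ≤ a + min l k`; since `j ≤ n -
    -- 1 = a + k`, only `j - a ≤ l` remains.
    have hset : {k : Fin n | (j : ℕ) + (k : ℕ) ≤ ∑ l ∈ Finset.Iic k, starSeq n a l} =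
        Set.Ici ⟨j - a, by omega⟩ := by
      ext l
      simp only [Set.mem_ofPred_eq, sum_Iic_starSeq h, Set.mem_Ici, Fin.le_def]
      omega
    rw [hset]
    have hl : IsLeast (Set.Ici (⟨j - a, by omega⟩ : Fin n)) ⟨j - a, by omega⟩ := isLeast_Ici
    constructor
    · intro h
      exact congrArg Fin.val (h.unique hl)
    · intro h
      have : i = ⟨j - a, by omega⟩ := Fin.ext h
      rwa [this]
  simp only [extremalTree, bfsTree, fromRel_adj, key, ne_eq, Fin.ext_iff]
  omega

lemma extremalTree_nonempty_iso (h : a + 1 + k = n) (hka : k < a) :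
    Nonempty (starWithPendants a k ≃g extremalTree n a) := by
  let f : Unit ⊕ Fin a ⊕ Fin k → Fin n :=
    Sum.elim (fun _ => ⟨0, by omega⟩)
      (Sum.elim (fun i => ⟨i + 1, by omega⟩) (fun j => ⟨a + 1 + j, by omega⟩))
  have hinj : Function.Injective f := by
    rintro (⟨⟩ | i | j) (⟨⟩ | i' | j') <;> simp [f, Fin.ext_iff] <;> omega
  have hbij : Function.Bijective f := (Fintype.bijective_iff_injective_and_card f).2
    ⟨hinj, by rw [← Nat.card_eq_fintype_card, starWithPendants_card, h, Fintype.card_fin]⟩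
  refine ⟨Equiv.ofBijective f hbij, ?_⟩
  intro p q
  change (extremalTree n a).Adj (f p) (f q) ↔ _
  rw [extremalTree_adj h hka]
  rcases p with ⟨⟩ | i | j <;> rcases q with ⟨⟩ | i' | j'
  · simp [f]
  · simp [f, starWithPendants_adj_center_leaf]
  · simp [f, starWithPendants_not_adj_center_pendant]
    omega
  · rw [adj_comm (starWithPendants a k)]
    simp [f, starWithPendants_adj_center_leaf]
  · simp [f, starWithPendants_not_adj_leaf_leaf]
  · simp [f, starWithPendants_adj_leaf_pendant]
    omega
  · rw [adj_comm (starWithPendants a k)]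
    simp [f, starWithPendants_not_adj_center_pendant]
    omega
  · rw [adj_comm (starWithPendants a k)]
    simp [f, starWithPendants_adj_leaf_pendant]
    omega
  · simp [f, starWithPendants_not_adj_pendant_pendant]
    omega

lemma extremalTree_degree (h : a + 1 + k = n) (hka : k < a) (i : Fin n)
    [Fintype ((extremalTree n a).neighborSet i)] :
    (extremalTree n a).degree i = starSeq n a i := by
  rw [← card_neighborFinset_eq_degree]
  by_cases hi : (i : ℕ) = 0
  · have : (extremalTree n a).neighborFinset i =
        Finset.univ.image fun j : Fin a => (⟨j + 1, by omega⟩ : Fin n) := by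
      ext l
      simp only [mem_neighborFinset, extremalTree_adj h hka, Finset.mem_image, Finset.mem_univ,
        true_and, Fin.ext_iff]
      constructor
      · intro hl
        exact ⟨⟨l - 1, by omega⟩, by simp only; omega⟩
      · rintro ⟨j, hj⟩
        omega
    rw [this, Finset.card_image_of_injective]
    · simp [starSeq, hi]
    · intro j j' hj
      simpa [Fin.ext_iff] using hj
  · by_cases hik : (i : ℕ) ≤ k
    · have : (extremalTree n a).neighborFinset i =
          {⟨0, by omega⟩, ⟨a + i, by omega⟩} := by
        ext l
        simp only [mem_neighborFinset, extremalTree_adj h hka, Finset.mem_insert,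
          Finset.mem_singleton, Fin.ext_iff]
        omega
      rw [this, Finset.card_pair (by simp [Fin.ext_iff]; omega)]
      simp only [starSeq]
      split_ifs <;> omega
    · have : (extremalTree n a).neighborFinset i = {⟨i - a, by omega⟩} := by
        ext l
        simp only [mem_neighborFinset, extremalTree_adj h hka, Finset.mem_singleton, Fin.ext_iff]
        omega
      rw [this, Finset.card_singleton]
      simp only [starSeq]
      split_ifs <;> omega

lemma extremalTree_hasDegreeSequence (h : a + 1 + k = n) (hka : k < a) :
    HasDegreeSequence (extremalTree n a) (starSeq n a) := by
  refine ⟨fun i j hij => ?_, Multiset.map_congr rfl ?_⟩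
  · rw [Fin.le_def] at hij
    simp only [starSeq]
    split_ifs <;> omega
  · intro i _
    classical
    convert extremalTree_degree h hka i

end ExtremalTree

/-! ### Subtrees as connected sets, and invariance under isomorphism -/

section Transfer

open SimpleGraph

variable {V V' : Type*} {G : SimpleGraph V} {G' : SimpleGraph V'}

/-- In a forest the graph induced on the vertices of a subtree is itself a tree, so by minimality it
equals the subtree. -/
lemma subtreeCount_eq_connCount [Fintype V] (hG : G.IsAcyclic) :
    subtreeCount G = connCount G Finset.univ ∅ := by
  classical
  have hmem : ∀ S : Finset V, S ∈ connSets G Finset.univ ∅ ↔ (G.induce (S : Set V)).Connected :=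
    fun S => by simp [mem_connSets]
  let f : {H : G.Subgraph // H.coe.IsTree} → {S : Finset V // S ∈ connSets G Finset.univ ∅} :=
    fun H => ⟨H.1.verts.toFinset, by
      rw [hmem, Set.coe_toFinset]
      exact Subgraph.Connected.induce_verts (Subgraph.connected_iff'.2 H.2.connected)⟩
  have hf : Function.Bijective f := by
    constructor
    · intro H H' hHH
      have hind : ∀ H : {H : G.Subgraph // H.coe.IsTree},
          H.1 = (⊤ : G.Subgraph).induce H.1.verts := by
        rintro ⟨H, hH⟩
        refine le_antisymm Subgraph.le_induce_top_verts ⟨subset_rfl, ?_⟩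
        rintro u v ⟨hu, hv, huv⟩
        have hT : (G.induce H.verts).IsTree :=
          ⟨Subgraph.Connected.induce_verts (Subgraph.connected_iff'.2 hH.connected), hG.induce _⟩
        have hle : H.coe ≤ G.induce H.verts := fun x y hxy => H.adj_sub hxy
        exact (isTree_iff_minimal_connected.1 hT).2 hH.connected hle
          (show (G.induce H.verts).Adj ⟨u, hu⟩ ⟨v, hv⟩ from huv)
      have hv : H.1.verts = H'.1.verts := Set.toFinset_inj.1 (congrArg Subtype.val hHH)
      exact Subtype.ext (by rw [hind H, hind H', hv])
    · rintro ⟨S, hS⟩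
      rw [hmem] at hS
      refine ⟨⟨(⊤ : G.Subgraph).induce S, ?_⟩, ?_⟩
      · rw [← induce_eq_coe_induce_top]
        exact ⟨hS, hG.induce _⟩
      · apply Subtype.ext
        ext v
        simp [f]
  rw [subtreeCount, Nat.card_eq_of_bijective f hf]
  simp [connCount]

lemma connCount_univ_le_of_iso [Fintype V] [Fintype V'] (e : G ≃g G') :
    connCount G Finset.univ ∅ ≤ connCount G' Finset.univ ∅ := by
  refine Finset.card_le_card_of_injOn (fun S => S.map e.toEquiv.toEmbedding) ?_
    (Finset.map_injective _).injOn
  intro S hS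
  simp only [Finset.mem_coe, mem_connSets, Finset.subset_univ, Finset.empty_subset,
    true_and] at hS ⊢
  have hbij : Set.BijOn e (S : Set V) (S.map e.toEquiv.toEmbedding : Finset V') := by
    rw [Finset.coe_map]
    exact e.toEquiv.injective.injOn.bijOn_image
  exact (e.induce hbij).connected_iff.1 hS

lemma connCount_univ_eq_of_iso [Fintype V] [Fintype V'] (e : G ≃g G') :
    connCount G Finset.univ ∅ = connCount G' Finset.univ ∅ :=
  le_antisymm (connCount_univ_le_of_iso e) (connCount_univ_le_of_iso e.symm)

lemma SimpleGraph.Iso.indepNum_le [Finite V] [Finite V'] (e : G ≃g G') :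
    G.indepNum ≤ G'.indepNum := by
  obtain ⟨S, hS⟩ := G.exists_isNIndepSet_indepNum
  have : G'.IsIndepSet ((S.map e.toEquiv.toEmbedding : Finset V') : Set V') := by
    rw [Finset.coe_map]
    rintro _ ⟨x, hx, rfl⟩ _ ⟨y, hy, rfl⟩ hxy h
    exact hS.isIndepSet hx hy (fun h => hxy (h ▸ rfl)) (e.map_adj_iff.1 h)
  simpa [hS.card_eq] using this.card_le_indepNum

lemma SimpleGraph.Iso.indepNum_eq [Finite V] [Finite V'] (e : G ≃g G') :
    G.indepNum = G'.indepNum :=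
  le_antisymm e.indepNum_le e.symm.indepNum_le

lemma mem_treesWithIndepNum_of_iso [Finite V] [Finite V'] (e : G ≃g G') {a : ℕ}
    (h : G' ∈ treesWithIndepNum V' a) : G ∈ treesWithIndepNum V a :=
  ⟨e.isTree_iff.2 h.1, e.indepNum_eq.trans h.2⟩

end Transfer

/-- The structure of the trees of order `n` with independence number `α`. -/
lemma SimpleGraph.IsTree.totalBound {V : Type*} [Fintype V] {T : SimpleGraph V} (hT : T.IsTree)
    (hV : 2 ≤ Fintype.card V) :
    ∃ k, T.indepNum + 1 + k = Fintype.card V ∧ k < T.indepNum ∧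
      TotalBound T Finset.univ T.indepNum k := by
  classical
  have hconn : (T.induce ((Finset.univ : Finset V) : Set V)).Connected := by
    rw [Finset.coe_univ]
    exact (SimpleGraph.induceUnivIso T).connected_iff.2 hT.connected
  obtain ⟨k, h1, h2, -, h4⟩ := hT.isAcyclic.bounds Finset.univ Finset.card_univ hV hconn
  rw [indepOn_univ] at h1 h2 h4
  rw [Finset.card_univ] at h1
  exact ⟨k, h1.symm, h2, h4⟩

theorem corollary5p4 {V : Type*} [Fintype V] (n α : ℕ) (hn : 2 ≤ n) (hV : Fintype.card V = n)
    (hne : (treesWithIndepNum V α).Nonempty) :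
    -- `T*` belongs to the class and is the star with `n - α - 1` pendent edges added
    (extremalTree n α ∈ treesWithIndepNum (Fin n) α ∧
      HasDegreeSequence (extremalTree n α) (starSeq n α) ∧
      ∃ k : ℕ, α + 1 + k = n ∧ k ≤ α ∧
        Nonempty (extremalTree n α ≃g starWithPendants α k)) ∧
    -- it is the only optimal tree
    (∀ T : SimpleGraph V,
      IsOptimal (treesWithIndepNum V α) T ↔ Nonempty (T ≃g extremalTree n α)) ∧
    -- the bound, with its case of equality
    (∀ T ∈ treesWithIndepNum V α,
      (subtreeCount T : ℚ) ≤
        2 ^ (2 * (α : ℤ) - n + 1) * 3 ^ ((n : ℤ) - α - 1) + 2 * n - α - 2 ∧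
      ((subtreeCount T : ℚ) =
          2 ^ (2 * (α : ℤ) - n + 1) * 3 ^ ((n : ℤ) - α - 1) + 2 * n - α - 2 ↔
        Nonempty (T ≃g extremalTree n α))) := by
  obtain ⟨k, hk, hka⟩ : ∃ k, α + 1 + k = n ∧ k < α := by
    obtain ⟨T, hT, rfl⟩ := hne
    obtain ⟨k, h1, h2, -⟩ := hT.totalBound (by omega)
    exact ⟨k, by omega, h2⟩
  obtain ⟨e⟩ := extremalTree_nonempty_iso hk hka
  have hmem : extremalTree n α ∈ treesWithIndepNum (Fin n) α :=
    mem_treesWithIndepNum_of_iso e.symm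
      ⟨starWithPendants_isTree hka.le, starWithPendants_indepNum hka⟩
  have hbound : ∀ T ∈ treesWithIndepNum V α,
      subtreeCount T ≤ 2 ^ (α - k) * 3 ^ k + α + 2 * k ∧
      (subtreeCount T = 2 ^ (α - k) * 3 ^ k + α + 2 * k → Nonempty (T ≃g extremalTree n α)) := by
    rintro T ⟨hT, hTα⟩
    obtain ⟨k', h1, h2, h3⟩ := hT.totalBound (by omega)
    rw [hTα] at h1 h2 h3
    obtain rfl : k = k' := by omega
    rw [subtreeCount_eq_connCount hT.isAcyclic]
    refine ⟨h3.1, fun heq => ?_⟩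
    obtain ⟨r, -, hr⟩ := h3.2 heq
    obtain ⟨e'⟩ := hT.nonempty_iso_starWithPendants hka.le (by omega) hr
    exact ⟨e'.trans e⟩
  have hiso : ∀ T : SimpleGraph V, Nonempty (T ≃g extremalTree n α) →
      T ∈ treesWithIndepNum V α ∧ subtreeCount T = 2 ^ (α - k) * 3 ^ k + α + 2 * k := by
    rintro T ⟨e'⟩
    have hT := mem_treesWithIndepNum_of_iso e' hmem
    refine ⟨hT, ?_⟩
    rw [subtreeCount_eq_connCount hT.1.isAcyclic, connCount_univ_eq_of_iso (e'.trans e.symm),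
      connCount_starWithPendants hka.le]
  -- With `n = α + 1 + k` the integer exponents are the natural numbers `α - k` and `k`, and `2n - α
  -- - 2 = α + 2k`.
  have hval : (2 : ℚ) ^ (2 * (α : ℤ) - n + 1) * 3 ^ ((n : ℤ) - α - 1) + 2 * n - α - 2 =
      ((2 ^ (α - k) * 3 ^ k + α + 2 * k : ℕ) : ℚ) := by
    have h1 : 2 * (α : ℤ) - n + 1 = ((α - k : ℕ) : ℤ) := by omega
    have h2 : (n : ℤ) - α - 1 = (k : ℤ) := by omega
    rw [h1, h2, zpow_natCast, zpow_natCast, ← hk]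
    push_cast
    ring
  refine ⟨⟨hmem, extremalTree_hasDegreeSequence hk hka, k, hk, hka.le, ⟨e.symm⟩⟩,
    fun T => ⟨fun hT => ?_, fun hT => ?_⟩, fun T hT => ?_⟩
  -- A copy of the extremal tree on `V` lies in the class and attains the bound, so an optimal tree
  -- attains it too.
  · let c : V ≃ Fin n := Fintype.equivFinOfCardEq hV
    obtain ⟨h1, h2⟩ := hiso _ ⟨SimpleGraph.Iso.comap c (extremalTree n α)⟩
    exact (hbound T hT.1).2 (le_antisymm (hbound T hT.1).1 (h2 ▸ hT.2 _ h1))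
  · obtain ⟨h1, h2⟩ := hiso T hT
    exact ⟨h1, fun T' hT' => h2 ▸ (hbound T' hT').1⟩
  · rw [hval]
    exact ⟨by exact_mod_cast (hbound T hT).1,
      fun h => (hbound T hT).2 (by exact_mod_cast h), fun h => by exact_mod_cast (hiso T h).2⟩
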